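/- Let $R$ be a domain, i.e. an associative, not necessarily commutative, nonzero ring with $1$ and without zero divisors. A unary pp formula for left $R$-modules is a formula $\varphi(x)=\exists\bar y\,(A\bar y = b x)$ with $A$ an $m\times k$ matrix and $b$ a column of length $m$ over $R$; in a left module $M$ it defines the subgroup $\varphi(M)=\{x\in M : A\bar y=bx \text{ for some } \bar y\in M^k\}$. A module $M$ is absolutely pure if it is pure in every module $N$ containing it, i.e. $\varphi(M)=M\cap\varphi(N)$ for all unary pp formulas $\varphi$; it is called flat-sharp if it is nonzero, flat and absolutely pure. A unary pp formula $\varphi$ is called high if $\varphi(N)=N$ for every absolutely pure module $N$; low if $\varphi(F)=0$ for every flat module $F$; bounded if there is $0\ne r\in R$ with $r\varphi(M)=0$ for all modules $M$; cobounded if there is $0\neq s\in R$ with $sM\subseteq\varphi(M)$ for all modules $M$. The analogous notions for right modules are defined symmetrically. ${\rm E}(-)$ denotes the injective hull. The following are equivalent. (i) $R$ is two-sided Ore: $Ra\cap Rb\neq 0$ and $aR\cap bR\ne 0$ for all nonzero $a,b\in R$. (ii) The left module ${\rm E}({}_RR)$ is flat. (iii) The right module ${\rm E}(R_R)$ is flat.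 (iv) There is a flat-sharp left $R$-module or a flat-sharp right $R$-module. (v) There are both a flat-sharp left $R$-module and a flat-sharp right $R$-module. (vi) There is no unary pp formula, for left or for right modules, that is both high and low. (vii) Both for left and for right modules, the unary pp formulas are partitioned into the region of formulas that are high and cobounded, which contains every divisibility formula $r\mid x$ with $0\neq r\in R$, and the region of formulas that are low and bounded, which contains every annihilation formula $rx=0$ with $0\ne r\in R$ (with scalars on the other side, $xr=0$, for right modules). Moreover, if ${\rm E}({}_RR)$ is flat then it is flat-sharp, and if ${\rm E}(R_R)$ is flat then it is flat-sharp. -/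

import Mathlib

/-! Left modules over a ring `S` are Mathlib modules over `S`; right `R`-modules are modules over
`Rᵐᵒᵖ`.  All notions below are stated for left modules over an arbitrary ring and are used for right
`R`-modules by taking that ring to be `Rᵐᵒᵖ`. -/

namespace PPMod

open scoped TensorProduct

universe u

section Tensor

variable (R : Type u) [Ring R]

/-- The relations `(a r) ⊗ m = a ⊗ (r m)` that turn `A ⊗_ℤ M` into `A ⊗_R M`. -/
def balancedRel (A : Type u) [AddCommGroup A] [Module Rᵐᵒᵖ A]
    (M : Type u) [AddCommGroup M] [Module R M] : AddSubgroup (A ⊗[ℤ] M) :=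
  AddSubgroup.closure
    {t | ∃ (a : A) (r : R) (m : M), t = (MulOpposite.op r • a) ⊗ₜ[ℤ] m - a ⊗ₜ[ℤ] (r • m)}

/-- The abelian group `A ⊗_R M` for a right module `A` and a left module `M` over a
(noncommutative) ring `R`. -/
abbrev BalancedTensor (A : Type u) [AddCommGroup A] [Module Rᵐᵒᵖ A]
    (M : Type u) [AddCommGroup M] [Module R M] : Type u :=
  (A ⊗[ℤ] M) ⧸ balancedRel R A M

theorem balancedRel_le_comap {A B : Type u} [AddCommGroup A] [Module Rᵐᵒᵖ A]
    [AddCommGroup B] [Module Rᵐᵒᵖ B] (M : Type u) [AddCommGroup M] [Module R M]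
    (f : A →ₗ[Rᵐᵒᵖ] B) :
    balancedRel R A M ≤ (balancedRel R B M).comap
      (LinearMap.rTensor M f.toAddMonoidHom.toIntLinearMap).toAddMonoidHom := by
  refine (AddSubgroup.closure_le _).2 ?_
  rintro _ ⟨a, r, m, rfl⟩
  refine AddSubgroup.subset_closure ⟨f a, r, m, ?_⟩
  simp

/-- The map `f ⊗ M : A ⊗_R M → B ⊗_R M`. -/
def BalancedTensor.map {A B : Type u} [AddCommGroup A] [Module Rᵐᵒᵖ A]
    [AddCommGroup B] [Module Rᵐᵒᵖ B] (M : Type u) [AddCommGroup M] [Module R M]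
    (f : A →ₗ[Rᵐᵒᵖ] B) : BalancedTensor R A M →+ BalancedTensor R B M :=
  QuotientAddGroup.map _ _
    (LinearMap.rTensor M f.toAddMonoidHom.toIntLinearMap).toAddMonoidHom
    (balancedRel_le_comap R M f)

/-- A left module `M` is flat if `- ⊗_R M` preserves injectivity of maps of right modules. -/
def IsFlat (M : Type u) [AddCommGroup M] [Module R M] : Prop :=
  ∀ (A B : Type u) [AddCommGroup A] [Module Rᵐᵒᵖ A] [AddCommGroup B] [Module Rᵐᵒᵖ B]
    (f : A →ₗ[Rᵐᵒᵖ] B), Function.Injective f → Function.Injective (BalancedTensor.map R M f)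

end Tensor

section Hull

variable {R : Type u} [Ring R]

/-- `i : M → E` is an injective hull: an essential embedding into an injective module. -/
structure IsInjectiveHull {M E : Type u} [AddCommGroup M] [Module R M]
    [AddCommGroup E] [Module R E] (i : M →ₗ[R] E) : Prop where
  embedding : Function.Injective i
  essential : ∀ N : Submodule R E, N ⊓ LinearMap.range i = ⊥ → N = ⊥
  injective : Module.Injective R E

/-- A maximal essential extension of `L` inside an injective module is injective. -/
theorem exists_injective_essential {J : Type u} [AddCommGroup J] [Module R J]
    [hJ : Module.Injective R J] (L : Submodule R J) :
    ∃ E : Submodule R J, L ≤ E ∧ (∀ N ≤ E, N ⊓ L = ⊥ → N = ⊥) ∧ Module.Injective R E := by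
  obtain ⟨E, hLE, hE⟩ := zorn_le_nonempty₀
    {E : Submodule R J | L ≤ E ∧ ∀ N ≤ E, N ⊓ L = ⊥ → N = ⊥}
    (fun c hc hchain y hy => by
      refine ⟨sSup c, ⟨(hc hy).1.trans (le_sSup hy), fun N hN hNL => ?_⟩,
        fun z hz => le_sSup hz⟩
      refine (Submodule.eq_bot_iff _).2 fun x hx => ?_
      obtain ⟨z, hz, hxz⟩ := (Submodule.mem_sSup_of_directed ⟨y, hy⟩ hchain.directedOn).1 (hN hx)
      have h1 : Submodule.span R {x} = ⊥ := by
        refine (hc hz).2 _ ((Submodule.span_singleton_le_iff_mem _ _).2 hxz) ?_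
        refine eq_bot_iff.2 (le_trans (inf_le_inf_right _ ?_) hNL.le)
        exact (Submodule.span_singleton_le_iff_mem _ _).2 hx
      exact Submodule.span_singleton_eq_bot.1 h1)
    L ⟨le_rfl, fun N hN hNL => by rwa [inf_eq_left.2 hN] at hNL⟩
  obtain ⟨⟨hLE, hEss⟩, hmax⟩ := hE
  obtain ⟨C, -, hC⟩ := zorn_le_nonempty₀ {C : Submodule R J | C ⊓ E = ⊥}
    (fun c hc hchain y hy => by
      refine ⟨sSup c, (Submodule.eq_bot_iff _).2 fun x hx => ?_, fun z hz => le_sSup hz⟩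
      obtain ⟨z, hz, hxz⟩ := (Submodule.mem_sSup_of_directed ⟨y, hy⟩ hchain.directedOn).1 hx.1
      exact (Submodule.eq_bot_iff _).1 (hc hz) x ⟨hxz, hx.2⟩)
    ⊥ (by simp)
  obtain ⟨hCE, hCmax⟩ := hC
  have hCE' : C ⊓ E = ⊥ := hCE
  -- `E` embeds in `J ⧸ C`
  have hinj : Function.Injective (C.mkQ ∘ₗ E.subtype) := by
    rw [← LinearMap.ker_eq_bot, Submodule.eq_bot_iff]
    intro x hx
    have hxC : (x : J) ∈ C := by simpa using hx
    exact Subtype.ext ((Submodule.eq_bot_iff _).1 hCE' x ⟨hxC, x.2⟩)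
  obtain ⟨g, hg⟩ := hJ.out (C.mkQ ∘ₗ E.subtype) hinj E.subtype
  -- the composite `J → J ⧸ C → J` is the identity on `E`
  let h : J →ₗ[R] J := g ∘ₗ C.mkQ
  have hid : ∀ x : E, h x = x := fun x => hg x
  have hker : LinearMap.ker h = C := by
    refine (hCmax ?_ ?_).antisymm ?_
    · refine (Submodule.eq_bot_iff _).2 fun x hx => ?_
      have := hid ⟨x, hx.2⟩
      rw [show h x = 0 from hx.1] at this
      exact this.symm
    · intro x hx
      have : C.mkQ x = 0 := by simpa using hx
      simp [h, this]
    · intro x hx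
      have : C.mkQ x = 0 := by simpa using hx
      simp [h, this]
  have hEr : E ≤ LinearMap.range h := fun x hx => ⟨x, hid ⟨x, hx⟩⟩
  have hrE : LinearMap.range h ≤ E := by
    refine hmax ⟨hLE.trans hEr, fun N hN hNL => ?_⟩ hEr
    have hNE : N ⊓ E = ⊥ := hEss _ inf_le_right (by
      rw [inf_assoc, inf_eq_right.2 hLE, hNL])
    -- the preimage of `N` misses `E`, so it is `C`
    have hpre : N.comap h ⊓ E = ⊥ := by
      refine (Submodule.eq_bot_iff _).2 fun x hx => ?_
      have h1 : h x ∈ N := hx.1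
      rw [hid ⟨x, hx.2⟩] at h1
      exact (Submodule.eq_bot_iff _).1 hNE x ⟨h1, hx.2⟩
    have hle : N.comap h ≤ C := hCmax hpre (by
      rw [← hker]
      intro x hx
      have : h x = 0 := hx
      simp [this])
    refine (Submodule.eq_bot_iff _).2 fun x hx => ?_
    obtain ⟨y, rfl⟩ := hN hx
    have : y ∈ LinearMap.ker h := hker ▸ hle hx
    exact this
  refine ⟨E, hLE, hEss, ⟨fun X Y _ _ _ _ f hf k => ?_⟩⟩
  obtain ⟨l, hl⟩ := hJ.out f hf (E.subtype ∘ₗ k)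
  refine ⟨(h.codRestrict E fun x => hrE ⟨x, rfl⟩) ∘ₗ l, fun x => ?_⟩
  refine Subtype.ext ?_
  have : l (f x) = (k x : J) := hl x
  simp [this, hid]

theorem exists_isInjectiveHull (R : Type u) [Ring R] (M : Type u) [AddCommGroup M] [Module R M] :
    ∃ (E : ModuleCat.{u} R) (i : M →ₗ[R] E), IsInjectiveHull i := by
  obtain ⟨P⟩ := CategoryTheory.EnoughInjectives.presentation (ModuleCat.of R M)
  have hPo : CategoryTheory.Injective (ModuleCat.of R P.J) := P.injective
  have hPi : Module.Injective R P.J := Module.injective_module_of_injective_object R P.J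
  have hPm : Function.Injective P.f.hom := (ModuleCat.mono_iff_injective _).1 inferInstance
  let f : M →ₗ[R] P.J := P.f.hom
  obtain ⟨E, hLE, hEss, hE⟩ := exists_injective_essential (LinearMap.range f)
  refine ⟨ModuleCat.of R E, f.codRestrict E fun x => hLE ⟨x, rfl⟩, ?_, ?_, hE⟩
  · intro x y hxy
    exact hPm (congrArg Subtype.val hxy)
  · intro N hN
    have h1 : N.map E.subtype = ⊥ := by
      refine hEss _ (by rintro _ ⟨x, -, rfl⟩; exact x.2) ?_
      refine (Submodule.eq_bot_iff _).2 ?_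
      rintro _ ⟨⟨x, hx, rfl⟩, ⟨m, hm⟩⟩
      have : x ∈ N ⊓ LinearMap.range (f.codRestrict E fun x => hLE ⟨x, rfl⟩) :=
        ⟨hx, m, Subtype.ext hm⟩
      rw [hN] at this
      have h0 : x = 0 := this
      simp [h0]
    refine (Submodule.eq_bot_iff _).2 fun x hx => Subtype.ext ?_
    exact (Submodule.eq_bot_iff _).1 h1 _ ⟨x, hx, rfl⟩

/-- `E(M)`, the injective hull of the module `M`. -/
noncomputable def InjectiveHull (R : Type u) [Ring R] (M : Type u) [AddCommGroup M] [Module R M] :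
    ModuleCat.{u} R :=
  (exists_isInjectiveHull R M).choose

end Hull

/-- A unary pp formula `∃ ȳ (A ȳ = b x)` for left modules over `R`, where `A` is an `m × k` matrix
and `b` a column of length `m` over `R`.  Over `Rᵐᵒᵖ` this is a unary pp formula
`∃ ȳ (ȳ C = x d)` for right `R`-modules. -/
structure PPFormula (R : Type u) where
  m : ℕ
  k : ℕ
  A : Matrix (Fin m) (Fin k) R
  b : Fin m → R

namespace PPFormula

variable {R : Type u} [Ring R]

/-- The pp subgroup `φ(M)` defined by `φ` in `M`. -/
def eval (φ : PPFormula R) (M : Type u) [AddCommGroup M] [Module R M] : AddSubgroup M where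
  carrier := {x | ∃ y : Fin φ.k → M, ∀ i, ∑ j, φ.A i j • y j = φ.b i • x}
  zero_mem' := ⟨0, by simp⟩
  add_mem' := by
    rintro x x' ⟨y, hy⟩ ⟨y', hy'⟩
    exact ⟨y + y', fun i => by simp [smul_add, Finset.sum_add_distrib, hy, hy']⟩
  neg_mem' := by
    rintro x ⟨y, hy⟩
    exact ⟨-y, fun i => by simp [hy]⟩

/-- The divisibility formula `r | x`. -/
def dvd (r : R) : PPFormula R := ⟨1, 1, fun _ _ => r, fun _ => 1⟩

/-- The annihilation formula `r x = 0`. -/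
def ann (r : R) : PPFormula R := ⟨1, 0, fun _ j => j.elim0, fun _ => r⟩

end PPFormula

section Regions

variable (R : Type u) [Ring R]

/-- `M` is absolutely pure: it is pure in every extension, i.e. `φ(M) = M ∩ φ(N)` for every
embedding of `M` in a module `N` and every unary pp formula `φ`. -/
def IsAbsolutelyPure (M : Type u) [AddCommGroup M] [Module R M] : Prop :=
  ∀ (N : Type u) [AddCommGroup N] [Module R N] (f : M →ₗ[R] N), Function.Injective f →
    ∀ (φ : PPFormula R) (x : M), x ∈ φ.eval M ↔ f x ∈ φ.eval N

/-- A flat-sharp module: nonzero, flat and absolutely pure. -/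
def IsFlatSharp (M : Type u) [AddCommGroup M] [Module R M] : Prop :=
  Nontrivial M ∧ IsFlat R M ∧ IsAbsolutelyPure R M

/-- There is a flat-sharp (left) module over `R`. -/
def HasFlatSharp : Prop :=
  ∃ M : ModuleCat.{u} R, IsFlatSharp R M

variable {R}

/-- `φ(N) = N` for all absolutely pure `N`. -/
def PPFormula.IsHigh (φ : PPFormula R) : Prop :=
  ∀ (N : Type u) [AddCommGroup N] [Module R N], IsAbsolutelyPure R N → φ.eval N = ⊤

/-- `φ(F) = 0` for all flat `F`. -/
def PPFormula.IsLow (φ : PPFormula R) : Prop :=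
  ∀ (F : Type u) [AddCommGroup F] [Module R F], IsFlat R F → φ.eval F = ⊥

/-- A single nonzero scalar annihilates `φ(M)` for all `M`. -/
def PPFormula.IsBounded (φ : PPFormula R) : Prop :=
  ∃ r : R, r ≠ 0 ∧ ∀ (M : Type u) [AddCommGroup M] [Module R M], ∀ x ∈ φ.eval M, r • x = 0

/-- A single nonzero scalar sends `M` into `φ(M)` for all `M`. -/
def PPFormula.IsCobounded (φ : PPFormula R) : Prop :=
  ∃ s : R, s ≠ 0 ∧ ∀ (M : Type u) [AddCommGroup M] [Module R M], ∀ x : M, s • x ∈ φ.eval M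

variable (R)

/-- The lattice of unary pp formulas for left `R`-modules is partitioned into the region of
formulas that are high and cobounded, which contains all `r | x` with `r ≠ 0`, and the region of
formulas that are low and bounded, which contains all `r x = 0` with `r ≠ 0`. -/
def HasTwoRegions : Prop :=
  (∀ φ : PPFormula R,
    ((φ.IsHigh ∧ φ.IsCobounded) ∨ (φ.IsLow ∧ φ.IsBounded)) ∧
    ¬ ((φ.IsHigh ∧ φ.IsCobounded) ∧ (φ.IsLow ∧ φ.IsBounded))) ∧
  (∀ r : R, r ≠ 0 →
    ((PPFormula.dvd r).IsHigh ∧ (PPFormula.dvd r).IsCobounded) ∧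
    ((PPFormula.ann r).IsLow ∧ (PPFormula.ann r).IsBounded))

end Regions

section Ore

variable (R : Type u) [Ring R]

/-- `Ra ∩ Rb ≠ 0` for all nonzero `a`, `b`. -/
def IsLeftOre : Prop :=
  ∀ a b : R, a ≠ 0 → b ≠ 0 → ∃ c d : R, c * a = d * b ∧ c * a ≠ 0

/-- `aR ∩ bR ≠ 0` for all nonzero `a`, `b`. -/
def IsRightOre : Prop :=
  ∀ a b : R, a ≠ 0 → b ≠ 0 → ∃ c d : R, a * c = b * d ∧ a * c ≠ 0

end Ore

end PPMod

/-!
A consistent system of linear equations is solvable in an injective module, and a linear implication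
which holds in `R` holds in every flat module.  Hence a formula `φ`, given by `A ȳ = b x`, is high
iff `p A = 0` implies `p b = 0` for all rows `p`, and low iff `φ(R) = 0`.  It follows that, over any
ring, cobounded means not low and bounded means not high.  Over a domain no formula is neither high
nor low: if `A c = b s` with `s ≠ 0`, then `p A = 0` gives `p b s = p A c = 0`, so `p b = 0`.  So
the two regions form a partition exactly when no formula is both high and low.  If `Ra ∩ Rb = 0`,
such a formula is `∃ y (a y = x ∧ b y = 0)`; if `aR ∩ bR = 0`, it is `∃ y (b y = a x)`.

Conversely, over a two-sided Ore domain all nonzero scalars act bijectively on the injective hull of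
a torsion-free module, and a module with this property is flat because its character module is
injective by Baer's criterion.
-/

namespace PPMod

open scoped TensorProduct Matrix

universe u

namespace BalancedTensor

variable {R : Type u} [Ring R] {A B C M : Type u} {P : Type*}
  [AddCommGroup A] [Module Rᵐᵒᵖ A] [AddCommGroup B] [Module Rᵐᵒᵖ B]
  [AddCommGroup C] [Module Rᵐᵒᵖ C] [AddCommGroup M] [Module R M] [AddCommGroup P]

/-- The pure tensor `a ⊗ m` in `A ⊗_R M`. -/
def tmul (a : A) (m : M) : BalancedTensor R A M :=
  QuotientAddGroup.mk (a ⊗ₜ[ℤ] m)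

theorem add_tmul (a b : A) (m : M) : tmul (R := R) (a + b) m = tmul a m + tmul b m :=
  congrArg QuotientAddGroup.mk (TensorProduct.add_tmul a b m)

theorem tmul_add (a : A) (m n : M) : tmul (R := R) a (m + n) = tmul a m + tmul a n :=
  congrArg QuotientAddGroup.mk (TensorProduct.tmul_add a m n)

theorem op_smul_tmul (a : A) (r : R) (m : M) :
    tmul (R := R) (MulOpposite.op r • a) m = tmul a (r • m) :=
  (QuotientAddGroup.eq_iff_sub_mem).2 (AddSubgroup.subset_closure ⟨a, r, m, rfl⟩)

theorem addHom_ext {f g : BalancedTensor R A M →+ P}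
    (h : ∀ a m, f (tmul a m) = g (tmul a m)) : f = g := by
  refine QuotientAddGroup.addMonoidHom_ext _ (AddMonoidHom.ext fun t => ?_)
  induction t using TensorProduct.induction_on with
  | zero => simp only [map_zero]
  | tmul a m => exact h a m
  | add t t' ht ht' => simp only [map_add, ht, ht']

/-- The additive map `A ⊗_R M → P` induced by a biadditive map `A × M → P` that is balanced. -/
noncomputable def lift (g : A →+ M →+ P)
    (hg : ∀ (a : A) (r : R) (m : M), g (MulOpposite.op r • a) m = g a (r • m)) :
    BalancedTensor R A M →+ P :=
  QuotientAddGroup.lift _ (TensorProduct.liftAddHom (R := ℤ) g fun n a m => by simp) <|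
    (AddSubgroup.closure_le _).2 <| by
      rintro _ ⟨a, r, m, rfl⟩
      simp [hg]

@[simp]
theorem lift_tmul (g : A →+ M →+ P)
    (hg : ∀ (a : A) (r : R) (m : M), g (MulOpposite.op r • a) m = g a (r • m)) (a : A) (m : M) :
    lift g hg (tmul a m) = g a m :=
  rfl

@[simp]
theorem map_tmul (f : A →ₗ[Rᵐᵒᵖ] B) (a : A) (m : M) : map R M f (tmul a m) = tmul (f a) m :=
  rfl

theorem map_comp (g : B →ₗ[Rᵐᵒᵖ] C) (f : A →ₗ[Rᵐᵒᵖ] B) :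
    map R M (g ∘ₗ f) = (map R M g).comp (map R M f) :=
  addHom_ext fun _ _ => rfl

variable (R A) in
/-- The isomorphism `A ⊗_R R ≃ A`. -/
noncomputable def rid : BalancedTensor R A R ≃+ A :=
  AddMonoidHom.toAddEquiv
    (lift (AddMonoidHom.mk' (fun a => AddMonoidHom.mk' (fun r => MulOpposite.op r • a)
      fun r s => by rw [MulOpposite.op_add, add_smul])
      fun a b => AddMonoidHom.ext fun r => smul_add _ a b) fun a r s => by simp [mul_smul])
    (AddMonoidHom.mk' (fun a => tmul a 1) fun a b => add_tmul a b 1)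
    (addHom_ext fun a r => by simp [op_smul_tmul])
    (AddMonoidHom.ext fun a => by simp)

variable (R M) in
/-- The isomorphism `R ⊗_R M ≃ M`. -/
noncomputable def lid : BalancedTensor R R M ≃+ M :=
  AddMonoidHom.toAddEquiv
    (lift (smulAddHom R M) fun a r m => by simp [mul_smul])
    (AddMonoidHom.mk' (fun m => tmul 1 m) fun m n => tmul_add 1 m n)
    (addHom_ext fun a m => show tmul 1 (a • m) = tmul a m by rw [← op_smul_tmul]; simp)
    (AddMonoidHom.ext fun m => one_smul R m)

@[simp]
theorem lid_tmul (r : R) (m : M) : lid R M (tmul r m) = r • m :=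
  rfl

theorem eq_zero_of_map_proj_eq_zero {ι : Type} [Finite ι] {A : ι → Type u}
    [∀ i, AddCommGroup (A i)] [∀ i, Module Rᵐᵒᵖ (A i)] {t : BalancedTensor R (∀ i, A i) M}
    (ht : ∀ i, map R M (LinearMap.proj i) t = 0) : t = 0 := by
  classical
  cases nonempty_fintype ι
  have decomposition : AddMonoidHom.id (BalancedTensor R (∀ i, A i) M) =
      ∑ i, (map R M (LinearMap.single Rᵐᵒᵖ A i)).comp (map R M (LinearMap.proj i)) :=
    addHom_ext fun a m => by
      let tmulHom : (∀ i, A i) →+ BalancedTensor R (∀ i, A i) M :=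
        AddMonoidHom.mk' (tmul · m) fun a b => add_tmul a b m
      simpa [tmulHom] using congrArg tmulHom (Finset.univ_sum_single a).symm
  simpa [ht] using DFunLike.congr_fun decomposition t

end BalancedTensor

section CharacterModule

variable {R : Type u} [Ring R] {A M : Type u} [AddCommGroup A] [Module Rᵐᵒᵖ A]
  [AddCommGroup M] [Module R M]

/-- The right action `(c r) m = c (r m)` of `R` on the character module of a left module. -/
noncomputable instance characterModuleOp : Module Rᵐᵒᵖ (CharacterModule M) :=
  inferInstanceAs (Module Rᵈᵐᵃ (M →+ AddCircle (1 : ℚ)))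

/-- The homomorphism `a ↦ c (a ⊗ -)` from `A` to the character module of `M` which corresponds to a
character `c` of `A ⊗_R M`. -/
noncomputable def BalancedTensor.curry (c : CharacterModule (BalancedTensor R A M)) :
    A →ₗ[Rᵐᵒᵖ] CharacterModule M where
  toFun a := AddMonoidHom.mk' (fun m => c (tmul a m)) fun m n => by rw [tmul_add, map_add]
  map_add' a b := CharacterModule.ext M fun m =>
    (congrArg c (add_tmul a b m)).trans (map_add c _ _)
  map_smul' r a := CharacterModule.ext M fun m => congrArg c (op_smul_tmul a r.unop m)

/-- The character `a ⊗ m ↦ h a m` of `A ⊗_R M` which corresponds to a homomorphism `h` from `A` to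
the character module of `M`. -/
noncomputable def BalancedTensor.uncurry (h : A →ₗ[Rᵐᵒᵖ] CharacterModule M) :
    CharacterModule (BalancedTensor R A M) :=
  lift (P := AddCircle (1 : ℚ)) h.toAddMonoidHom fun a r m =>
    congrArg (fun c : CharacterModule M => c m) (h.map_smul (MulOpposite.op r) a)

theorem isFlat_of_injective_characterModule (hM : Module.Injective Rᵐᵒᵖ (CharacterModule M)) :
    IsFlat R M := by
  intro A B _ _ _ _ f hf
  refine (injective_iff_map_eq_zero _).2 fun t ht =>
    CharacterModule.eq_zero_of_character_apply fun c => ?_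
  obtain ⟨h, hh⟩ := hM.out f hf (BalancedTensor.curry c)
  have extends_c : (AddMonoidHom.comp (BalancedTensor.uncurry h) (BalancedTensor.map R M f) :
      BalancedTensor R A M →+ AddCircle (1 : ℚ)) = c :=
    BalancedTensor.addHom_ext fun a m => congrArg (fun χ : CharacterModule M => χ m) (hh a)
  calc c t = BalancedTensor.uncurry h (BalancedTensor.map R M f t) :=
        (DFunLike.congr_fun extends_c t).symm
    _ = 0 := by rw [ht, map_zero]

theorem bijective_smul_characterModule {s : Rᵐᵒᵖ}
    (hs : Function.Bijective fun m : M => s.unop • m) :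
    Function.Bijective fun c : CharacterModule M => s • c := by
  let e : M ≃+ M := AddEquiv.ofBijective (DistribSMul.toAddMonoidHom M s.unop) hs
  refine ⟨fun c d hcd => CharacterModule.ext M fun m => ?_, fun c =>
    ⟨AddMonoidHom.comp c e.symm.toAddMonoidHom, CharacterModule.ext M fun m =>
      congrArg c (e.symm_apply_apply m)⟩⟩
  obtain ⟨m, rfl⟩ := hs.surjective m
  exact DFunLike.congr_fun hcd m

end CharacterModule

section Ore

variable {R : Type u} [Ring R]

theorem isLeftOre_op_iff : IsLeftOre Rᵐᵒᵖ ↔ IsRightOre R := by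
  simp [IsLeftOre, IsRightOre, MulOpposite.forall, MulOpposite.exists, ← MulOpposite.op_mul]

theorem isRightOre_op_iff : IsRightOre Rᵐᵒᵖ ↔ IsLeftOre R := by
  simp [IsLeftOre, IsRightOre, MulOpposite.forall, MulOpposite.exists, ← MulOpposite.op_mul]

theorem IsLeftOre.injective_of_bijective_smul (hR : IsLeftOre R) {N : Type u} [AddCommGroup N]
    [Module R N] (hN : ∀ s : R, s ≠ 0 → Function.Bijective fun n : N => s • n) :
    Module.Injective R N := by
  refine Module.Baer.injective fun I g => ?_
  obtain rfl | hI := eq_or_ne I ⊥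
  · rw [Subsingleton.elim g 0]
    exact ⟨0, fun _ _ => rfl⟩
  obtain ⟨s, hsI, hs⟩ := Submodule.exists_mem_ne_zero_of_ne_bot hI
  obtain ⟨y, hy : s • y = g ⟨s, hsI⟩⟩ := (hN s hs).surjective (g ⟨s, hsI⟩)
  refine ⟨LinearMap.toSpanSingleton R N y, fun x hx => ?_⟩
  obtain rfl | hx0 := eq_or_ne x 0
  · rw [map_zero]
    exact (map_zero g).symm
  obtain ⟨c, d, hcd, hne⟩ := hR x s hx0 hs
  refine (hN c (left_ne_zero_of_mul hne)).injective ?_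
  calc c • x • y = (d * s) • y := by rw [smul_smul, hcd]
    _ = d • g ⟨s, hsI⟩ := by rw [mul_smul, hy]
    _ = g (d • ⟨s, hsI⟩) := (map_smul g d _).symm
    _ = g (c • ⟨x, hx⟩) := congrArg g (Subtype.ext hcd.symm)
    _ = c • g ⟨x, hx⟩ := map_smul g c _

theorem IsRightOre.isFlat_of_bijective_smul (hR : IsRightOre R) {M : Type u} [AddCommGroup M]
    [Module R M] (hM : ∀ s : R, s ≠ 0 → Function.Bijective fun m : M => s • m) : IsFlat R M :=
  isFlat_of_injective_characterModule <|
    (isLeftOre_op_iff.2 hR).injective_of_bijective_smul fun s hs =>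
      bijective_smul_characterModule (hM s.unop (MulOpposite.unop_ne_zero_iff s |>.2 hs))

end Ore

section LinearSystems

variable {R : Type u} [Ring R]

theorem exists_comp_eq_of_ker_le {P Q J : Type u} [AddCommGroup P] [Module R P] [AddCommGroup Q]
    [Module R Q] [AddCommGroup J] [Module R J] (hJ : Module.Injective R J) {f : P →ₗ[R] Q}
    {c : P →ₗ[R] J} (hfc : LinearMap.ker f ≤ LinearMap.ker c) : ∃ h : Q →ₗ[R] J, h ∘ₗ f = c := by
  obtain ⟨h, hh⟩ := Module.Injective.extension_property R J _ _ ((LinearMap.ker f).liftQ f le_rfl)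
    (LinearMap.ker_eq_bot.1 (Submodule.ker_liftQ_eq_bot' _ f rfl)) ((LinearMap.ker f).liftQ c hfc)
  refine ⟨h, ?_⟩
  rw [← (LinearMap.ker f).liftQ_mkQ f le_rfl, ← LinearMap.comp_assoc, hh, Submodule.liftQ_mkQ]

theorem IsFlat.map_eq_zero_of_ker_le {P Q C F : Type u} [AddCommGroup P] [Module Rᵐᵒᵖ P]
    [AddCommGroup Q] [Module Rᵐᵒᵖ Q] [AddCommGroup C] [Module Rᵐᵒᵖ C] [AddCommGroup F] [Module R F]
    (hF : IsFlat R F) {g : P →ₗ[Rᵐᵒᵖ] Q} {c : P →ₗ[Rᵐᵒᵖ] C}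
    (hgc : LinearMap.ker g ≤ LinearMap.ker c) {t : BalancedTensor R P F}
    (ht : BalancedTensor.map R F g t = 0) : BalancedTensor.map R F c t = 0 := by
  have mkQ_eq_zero : BalancedTensor.map R F (LinearMap.ker g).mkQ t = 0 := by
    refine (injective_iff_map_eq_zero _).1 (hF _ _ ((LinearMap.ker g).liftQ g le_rfl)
      (LinearMap.ker_eq_bot.1 (Submodule.ker_liftQ_eq_bot' _ g rfl))) _ ?_
    rw [← AddMonoidHom.comp_apply, ← BalancedTensor.map_comp, Submodule.liftQ_mkQ, ht]
  rw [← (LinearMap.ker g).liftQ_mkQ c hgc, BalancedTensor.map_comp, AddMonoidHom.comp_apply,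
    mkQ_eq_zero, map_zero]

variable (R) in
theorem isFlat_self : IsFlat R R := by
  intro A B _ _ _ _ f hf
  have rid_natural : (BalancedTensor.rid R B).toAddMonoidHom.comp (BalancedTensor.map R R f) =
      f.toAddMonoidHom.comp (BalancedTensor.rid R A).toAddMonoidHom :=
    BalancedTensor.addHom_ext fun a r => (f.map_smul (MulOpposite.op r) a).symm
  have comp_injective := hf.comp (BalancedTensor.rid R A).injective
  refine .of_comp (f := BalancedTensor.rid R B) ?_
  rwa [show BalancedTensor.rid R B ∘ BalancedTensor.map R R f = f ∘ BalancedTensor.rid R A from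
    congrArg DFunLike.coe rid_natural]

end LinearSystems

section PPFormula

variable {R : Type u} [Ring R]

namespace PPFormula

theorem map_mem_eval (φ : PPFormula R) {M N : Type u} [AddCommGroup M] [Module R M]
    [AddCommGroup N] [Module R N] (f : M →ₗ[R] N) {x : M} (hx : x ∈ φ.eval M) :
    f x ∈ φ.eval N := by
  obtain ⟨y, hy⟩ := hx
  exact ⟨f ∘ y, fun i => by simp only [Function.comp_apply, ← map_smul, ← map_sum, hy i]⟩

theorem dotProduct_smul_eq_zero_of_mem_eval {φ : PPFormula R} {p : Fin φ.m → R}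
    (hp : p ᵥ* φ.A = 0) {M : Type u} [AddCommGroup M] [Module R M] {x : M} (hx : x ∈ φ.eval M) :
    (p ⬝ᵥ φ.b) • x = 0 := by
  obtain ⟨y, hy⟩ := hx
  calc (p ⬝ᵥ φ.b) • x = ∑ i, p i • φ.b i • x := by
        simp only [dotProduct, Finset.sum_smul, mul_smul]
    _ = ∑ i, ∑ j, p i • φ.A i j • y j := by simp only [← hy, Finset.smul_sum]
    _ = ∑ j, (p ᵥ* φ.A) j • y j := by
        rw [Finset.sum_comm]
        simp only [Matrix.vecMul, dotProduct, Finset.sum_smul, mul_smul]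
    _ = 0 := by simp only [hp, Pi.zero_apply, zero_smul, Finset.sum_const_zero]

theorem mem_eval_of_injective {φ : PPFormula R} {J : Type u} [AddCommGroup J] [Module R J]
    (hJ : Module.Injective R J) {x : J} (hx : ∀ p, p ᵥ* φ.A = 0 → (p ⬝ᵥ φ.b) • x = 0) :
    x ∈ φ.eval J := by
  let c : (Fin φ.m → R) →ₗ[R] J :=
    { toFun p := (p ⬝ᵥ φ.b) • x
      map_add' p q := by rw [add_dotProduct, add_smul]
      map_smul' r p := by rw [smul_dotProduct, smul_eq_mul, mul_smul, RingHom.id_apply] }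
  obtain ⟨h, hh⟩ := exists_comp_eq_of_ker_le hJ (f := Matrix.vecMulLinear φ.A) (c := c) hx
  refine ⟨fun j => h fun l => if j = l then 1 else 0, fun i => ?_⟩
  calc ∑ j, φ.A i j • h (fun l => if j = l then 1 else 0) = h (φ.A i) :=
        (h.pi_apply_eq_sum_univ (φ.A i)).symm
    _ = h (Pi.single i 1 ᵥ* φ.A) := by rw [Matrix.single_one_vecMul]; rfl
    _ = (Pi.single i 1 ⬝ᵥ φ.b) • x := DFunLike.congr_fun hh (Pi.single i 1)
    _ = φ.b i • x := by rw [single_one_dotProduct]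

end PPFormula

theorem isAbsolutelyPure_of_injective {J : Type u} [AddCommGroup J] [Module R J]
    (hJ : Module.Injective R J) : IsAbsolutelyPure R J := by
  intro N _ _ f hf φ x
  refine ⟨φ.map_mem_eval f, fun hx => ?_⟩
  obtain ⟨g, hg⟩ := hJ.out f hf LinearMap.id
  simpa only [hg, LinearMap.id_apply] using φ.map_mem_eval g hx

namespace PPFormula

variable {φ : PPFormula R}

theorem IsHigh.eq_zero_of_smul_eval_eq_zero (hφ : φ.IsHigh) {r : R}
    (hr : ∀ (M : Type u) [AddCommGroup M] [Module R M], ∀ x ∈ φ.eval M, r • x = 0) : r = 0 := by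
  obtain ⟨E, i, hi⟩ := exists_isInjectiveHull R R
  have mem_eval : i 1 ∈ φ.eval E :=
    (AddSubgroup.eq_top_iff' _).1 (hφ E (isAbsolutelyPure_of_injective hi.injective)) _
  refine (map_eq_zero_iff i hi.embedding).1 ?_
  rw [← hr E (i 1) mem_eval, ← map_smul, smul_eq_mul, mul_one]

theorem isHigh_iff : φ.IsHigh ↔ ∀ p, p ᵥ* φ.A = 0 → p ⬝ᵥ φ.b = 0 := by
  refine ⟨fun hφ p hp => ?_, fun hφ N _ _ hN => (AddSubgroup.eq_top_iff' _).2 fun x => ?_⟩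
  · exact hφ.eq_zero_of_smul_eval_eq_zero fun _ _ _ _ hx =>
      dotProduct_smul_eq_zero_of_mem_eval hp hx
  · obtain ⟨E, i, hi⟩ := exists_isInjectiveHull R N
    exact (hN E i hi.embedding φ x).2 <|
      mem_eval_of_injective hi.injective fun p hp => by rw [hφ p hp, zero_smul]

/-- The homomorphism `(v, s) ↦ A v - b s` of right modules, whose kernel consists of the solutions
of the system `A ȳ = b x` in `R`. -/
def residual (φ : PPFormula R) : (Fin φ.k → R) × R →ₗ[Rᵐᵒᵖ] (Fin φ.m → R) where
  toFun p i := φ.A i ⬝ᵥ p.1 - φ.b i * p.2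
  map_add' p q := by
    ext i
    simp only [Prod.fst_add, Prod.snd_add, dotProduct_add, mul_add, Pi.add_apply]
    abel
  map_smul' r p := by
    ext i
    simp [sub_mul, mul_assoc, dotProduct_smul]

theorem eval_eq_bot_of_isFlat (hφ : φ.eval R = ⊥) {F : Type u} [AddCommGroup F] [Module R F]
    (hF : IsFlat R F) : φ.eval F = ⊥ := by
  refine (AddSubgroup.eq_bot_iff_forall _).2 fun x ⟨y, hy⟩ => ?_
  have ker_le : LinearMap.ker φ.residual ≤
      LinearMap.ker (LinearMap.snd Rᵐᵒᵖ (Fin φ.k → R) R) := fun p hp =>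
    (AddSubgroup.eq_bot_iff_forall _).1 hφ p.2 ⟨p.1, fun i => sub_eq_zero.1 (congrFun hp i)⟩
  let t : BalancedTensor R ((Fin φ.k → R) × R) F :=
    ∑ j, BalancedTensor.tmul (Pi.single j 1, 0) (y j) + BalancedTensor.tmul (0, 1) x
  have residual_eq_zero : BalancedTensor.map R F φ.residual t = 0 :=
    BalancedTensor.eq_zero_of_map_proj_eq_zero fun i => (BalancedTensor.lid R F).injective <| by
      simp [t, residual, hy i]
  simpa [t] using
    congrArg (BalancedTensor.lid R F) (hF.map_eq_zero_of_ker_le ker_le residual_eq_zero)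

theorem isLow_iff : φ.IsLow ↔ φ.eval R = ⊥ :=
  ⟨fun hφ => hφ R (isFlat_self R), fun hφ _ _ _ => eval_eq_bot_of_isFlat hφ⟩

theorem isCobounded_iff_not_isLow : φ.IsCobounded ↔ ¬ φ.IsLow := by
  rw [isLow_iff, AddSubgroup.eq_bot_iff_forall]
  push Not
  constructor
  · rintro ⟨s, hs, hφ⟩
    exact ⟨s, by simpa using hφ R 1, hs⟩
  · rintro ⟨s, hsφ, hs⟩
    exact ⟨s, hs, fun M _ _ x => φ.map_mem_eval (LinearMap.toSpanSingleton R M x) hsφ⟩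

theorem isBounded_iff_not_isHigh : φ.IsBounded ↔ ¬ φ.IsHigh := by
  constructor
  · rintro ⟨r, hr, hφ⟩ hhigh
    exact hr (hhigh.eq_zero_of_smul_eval_eq_zero hφ)
  · rw [isHigh_iff]
    push Not
    rintro ⟨p, hp, hpb⟩
    exact ⟨p ⬝ᵥ φ.b, hpb, fun _ _ _ _ hx => dotProduct_smul_eq_zero_of_mem_eval hp hx⟩

theorem isHigh_or_isLow [NoZeroDivisors R] (φ : PPFormula R) : φ.IsHigh ∨ φ.IsLow := by
  refine or_iff_not_imp_right.2 fun hlow => isHigh_iff.2 fun p hp => ?_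
  rw [isLow_iff, AddSubgroup.eq_bot_iff_forall] at hlow
  push Not at hlow
  obtain ⟨s, hsφ, hs⟩ := hlow
  exact (mul_eq_zero.1 (dotProduct_smul_eq_zero_of_mem_eval hp hsφ)).resolve_right hs

theorem isCobounded_dvd {r : R} (hr : r ≠ 0) : (dvd r).IsCobounded :=
  ⟨r, hr, fun _ _ _ x => ⟨fun _ => x, fun _ => (Fin.sum_univ_one _).trans (one_smul R _).symm⟩⟩

theorem isHigh_dvd [NoZeroDivisors R] {r : R} (hr : r ≠ 0) : (dvd r).IsHigh :=
  (isHigh_or_isLow _).resolve_right (isCobounded_iff_not_isLow.1 (isCobounded_dvd hr))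

theorem isBounded_ann {r : R} (hr : r ≠ 0) : (ann r).IsBounded :=
  ⟨r, hr, fun _ _ _ _ ⟨_, hy⟩ => (hy (0 : Fin 1)).symm⟩

theorem isLow_ann [NoZeroDivisors R] {r : R} (hr : r ≠ 0) : (ann r).IsLow :=
  (isHigh_or_isLow _).resolve_left (isBounded_iff_not_isHigh.1 (isBounded_ann hr))

end PPFormula

theorem hasTwoRegions_iff [NoZeroDivisors R] :
    HasTwoRegions R ↔ ¬ ∃ φ : PPFormula R, φ.IsHigh ∧ φ.IsLow := by
  constructor
  · rintro h ⟨φ, hhigh, hlow⟩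
    obtain ⟨-, hφ⟩ | ⟨-, hφ⟩ := (h.1 φ).1
    · exact PPFormula.isCobounded_iff_not_isLow.1 hφ hlow
    · exact PPFormula.isBounded_iff_not_isHigh.1 hφ hhigh
  · intro h
    have isHigh_iff_not_isLow (φ : PPFormula R) : φ.IsHigh ↔ ¬ φ.IsLow :=
      ⟨fun hhigh hlow => h ⟨φ, hhigh, hlow⟩, φ.isHigh_or_isLow.resolve_right⟩
    refine ⟨fun φ => ?_, fun r hr =>
      ⟨⟨PPFormula.isHigh_dvd hr, PPFormula.isCobounded_dvd hr⟩,
        PPFormula.isLow_ann hr, PPFormula.isBounded_ann hr⟩⟩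
    rw [PPFormula.isCobounded_iff_not_isLow, PPFormula.isBounded_iff_not_isHigh,
      isHigh_iff_not_isLow]
    tauto

theorem HasFlatSharp.not_exists_isHigh_isLow (h : HasFlatSharp R) :
    ¬ ∃ φ : PPFormula R, φ.IsHigh ∧ φ.IsLow := by
  rintro ⟨φ, hhigh, hlow⟩
  obtain ⟨M, _, hflat, hpure⟩ := h
  exact bot_ne_top ((hlow M hflat).symm.trans (hhigh M hpure))

theorem exists_isHigh_isLow_of_not_isLeftOre [NoZeroDivisors R] (hR : ¬ IsLeftOre R) :
    ∃ φ : PPFormula R, φ.IsHigh ∧ φ.IsLow := by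
  unfold IsLeftOre at hR
  push Not at hR
  obtain ⟨a, b, ha, hb, hab⟩ := hR
  refine ⟨⟨2, 1, !![a; b], ![1, 0]⟩, PPFormula.isHigh_iff.2 fun p hp => ?_,
    PPFormula.isLow_iff.2 ((AddSubgroup.eq_bot_iff_forall _).2 fun x ⟨y, hy⟩ => ?_)⟩
  · have hp0 : p 0 * a + p 1 * b = 0 := by
      simpa [Matrix.vecMul, dotProduct, Fin.sum_univ_two] using congrFun hp 0
    have hpa : p 0 * a = 0 := hab (p 0) (-p 1) (by rw [neg_mul, eq_neg_of_add_eq_zero_left hp0])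
    simp [dotProduct, (mul_eq_zero.1 hpa).resolve_right ha]
  · obtain ⟨hay, hby⟩ : a * y 0 = x ∧ b * y 0 = 0 := by
      simpa [Fin.forall_fin_two] using hy
    rw [← hay, (mul_eq_zero.1 hby).resolve_left hb, mul_zero]

theorem exists_isHigh_isLow_of_not_isRightOre [NoZeroDivisors R] (hR : ¬ IsRightOre R) :
    ∃ φ : PPFormula R, φ.IsHigh ∧ φ.IsLow := by
  unfold IsRightOre at hR
  push Not at hR
  obtain ⟨a, b, ha, hb, hab⟩ := hR
  refine ⟨⟨1, 1, fun _ _ => b, fun _ => a⟩, PPFormula.isHigh_iff.2 fun p hp => ?_,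
    PPFormula.isLow_iff.2 ((AddSubgroup.eq_bot_iff_forall _).2 fun x ⟨y, hy⟩ => ?_)⟩
  · have hpb : p 0 * b = 0 := by simpa [Matrix.vecMul, dotProduct] using congrFun hp 0
    simp [dotProduct, (mul_eq_zero.1 hpb).resolve_right hb]
  · have hyx : b * y 0 = a * x := by simpa using hy
    exact (mul_eq_zero.1 (hab x (y 0) hyx.symm)).resolve_left ha

end PPFormula

section Hull

variable {R : Type u} [Ring R]

theorem surjective_smul_of_injective [NoZeroDivisors R] {J : Type u} [AddCommGroup J] [Module R J]
    (hJ : Module.Injective R J) {s : R} (hs : s ≠ 0) :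
    Function.Surjective fun x : J => s • x := by
  intro x
  obtain ⟨y, hy⟩ := (AddSubgroup.eq_top_iff' _).1
    (PPFormula.isHigh_dvd hs J (isAbsolutelyPure_of_injective hJ)) x
  exact ⟨y (0 : Fin 1),
    ((Fin.sum_univ_one _).symm.trans (hy (0 : Fin 1))).trans (one_smul R x)⟩

theorem IsInjectiveHull.injective_smul [NoZeroDivisors R] (hR : IsLeftOre R) {M E : Type u}
    [AddCommGroup M] [Module R M] [Module.IsTorsionFree R M] [AddCommGroup E] [Module R E]
    {i : M →ₗ[R] E} (hi : IsInjectiveHull i) {s : R} (hs : s ≠ 0) :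
    Function.Injective fun e : E => s • e := by
  refine (injective_iff_map_eq_zero (DistribSMul.toAddMonoidHom E s)).2 fun e he => ?_
  refine Submodule.span_singleton_eq_bot.1 (hi.essential _ ((Submodule.eq_bot_iff _).2 ?_))
  rintro _ ⟨hspan, x, rfl⟩
  obtain ⟨r, hr⟩ := Submodule.mem_span_singleton.1 hspan
  obtain rfl | hr0 := eq_or_ne r 0
  · rw [← hr, zero_smul]
  obtain ⟨c, d, hcd, hne⟩ := hR r s hr0 hs
  have smul_x_eq_zero : c • x = 0 := (map_eq_zero_iff i hi.embedding).1 <|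
    calc i (c • x) = d • s • e := by rw [map_smul, ← hr, smul_smul, hcd, mul_smul]
      _ = 0 := (congrArg (d • ·) he).trans (smul_zero d)
  rw [(smul_eq_zero_iff_right (left_ne_zero_of_mul hne)).1 smul_x_eq_zero, map_zero]

theorem exists_isInjectiveHull_injectiveHull (M : Type u) [AddCommGroup M] [Module R M] :
    ∃ i : M →ₗ[R] InjectiveHull R M, IsInjectiveHull i :=
  (exists_isInjectiveHull R M).choose_spec

theorem isFlat_injectiveHull [NoZeroDivisors R] (hl : IsLeftOre R) (hr : IsRightOre R) (M : Type u)
    [AddCommGroup M] [Module R M] [Module.IsTorsionFree R M] : IsFlat R (InjectiveHull R M) := by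
  obtain ⟨i, hi⟩ := exists_isInjectiveHull_injectiveHull (R := R) M
  exact hr.isFlat_of_bijective_smul fun s hs =>
    ⟨hi.injective_smul hl hs, surjective_smul_of_injective hi.injective hs⟩

theorem isFlatSharp_injectiveHull {M : Type u} [AddCommGroup M] [Module R M] [Nontrivial M]
    (h : IsFlat R (InjectiveHull R M)) : IsFlatSharp R (InjectiveHull R M) := by
  obtain ⟨i, hi⟩ := exists_isInjectiveHull_injectiveHull (R := R) M
  exact ⟨hi.embedding.nontrivial, h, isAbsolutelyPure_of_injective hi.injective⟩

theorem isLeftOre_and_isRightOre_tfae (R : Type u) [Ring R] [NoZeroDivisors R] (M : Type u)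
    [AddCommGroup M] [Module R M] [Nontrivial M] [Module.IsTorsionFree R M] :
    List.TFAE [
      IsLeftOre R ∧ IsRightOre R,
      IsFlat R (InjectiveHull R M),
      HasFlatSharp R,
      ¬ ∃ φ : PPFormula R, φ.IsHigh ∧ φ.IsLow,
      HasTwoRegions R] := by
  tfae_have 1 → 2 := fun h => isFlat_injectiveHull h.1 h.2 M
  tfae_have 2 → 3 := fun h => ⟨InjectiveHull R M, isFlatSharp_injectiveHull h⟩
  tfae_have 3 → 4 := HasFlatSharp.not_exists_isHigh_isLow
  tfae_have 4 → 1 := fun h => ⟨not_imp_comm.1 exists_isHigh_isLow_of_not_isLeftOre h,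
    not_imp_comm.1 exists_isHigh_isLow_of_not_isRightOre h⟩
  tfae_have 4 ↔ 5 := hasTwoRegions_iff.symm
  tfae_finish

end Hull

end PPMod

theorem mainTheorem3 (R : Type*) [Ring R] [IsDomain R] :
    List.TFAE [
      PPMod.IsLeftOre R ∧ PPMod.IsRightOre R,
      PPMod.IsFlat R (PPMod.InjectiveHull R R),
      PPMod.IsFlat Rᵐᵒᵖ (PPMod.InjectiveHull Rᵐᵒᵖ R),
      PPMod.HasFlatSharp R ∨ PPMod.HasFlatSharp Rᵐᵒᵖ,
      PPMod.HasFlatSharp R ∧ PPMod.HasFlatSharp Rᵐᵒᵖ,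
      (¬ ∃ φ : PPMod.PPFormula R, φ.IsHigh ∧ φ.IsLow) ∧
        (¬ ∃ φ : PPMod.PPFormula Rᵐᵒᵖ, φ.IsHigh ∧ φ.IsLow),
      PPMod.HasTwoRegions R ∧ PPMod.HasTwoRegions Rᵐᵒᵖ] ∧
    (PPMod.IsFlat R (PPMod.InjectiveHull R R) →
      PPMod.IsFlatSharp R (PPMod.InjectiveHull R R)) ∧
    (PPMod.IsFlat Rᵐᵒᵖ (PPMod.InjectiveHull Rᵐᵒᵖ R) →
      PPMod.IsFlatSharp Rᵐᵒᵖ (PPMod.InjectiveHull Rᵐᵒᵖ R)) := by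
  have left := PPMod.isLeftOre_and_isRightOre_tfae R R
  have right := PPMod.isLeftOre_and_isRightOre_tfae Rᵐᵒᵖ R
  rw [PPMod.isLeftOre_op_iff, PPMod.isRightOre_op_iff, and_comm] at right
  refine ⟨?_, PPMod.isFlatSharp_injectiveHull, PPMod.isFlatSharp_injectiveHull⟩
  tfae_have 1 ↔ 2 := left.out 0 1
  tfae_have 1 ↔ 3 := right.out 0 1
  tfae_have 1 ↔ 4 := or_self_iff.symm.trans (or_congr (left.out 0 2) (right.out 0 2))
  tfae_have 1 ↔ 5 := and_self_iff.symm.trans (and_congr (left.out 0 2) (right.out 0 2))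
  tfae_have 1 ↔ 6 := and_self_iff.symm.trans (and_congr (left.out 0 3) (right.out 0 3))
  tfae_have 1 ↔ 7 := and_self_iff.symm.trans (and_congr (left.out 0 4) (right.out 0 4))
  tfae_finish
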